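/- Let $\Bbbk$ be a field. A standard graded $\Bbbk$-algebra is $A=\bigoplus_{i\ge 0}A_i=T(V)/I$, where $V$ is a finite-dimensional $\Bbbk$-vector space and $I=I_2\oplus I_3\oplus\cdots$ is a homogeneous two-sided ideal of the tensor algebra (so $A_0=\Bbbk$ and $A_1=V$). It is Koszul if the trivial left module $\Bbbk=A/A_+$ has a linear free resolution $0\leftarrow\Bbbk\leftarrow A\leftarrow A(-1)^{\beta_1}\leftarrow A(-2)^{\beta_2}\leftarrow\cdots$ by left $A$-modules, i.e. a graded free resolution in which all matrix entries of the differentials lie in $A_1$. Its quadratic dual is $A^!=T(V^*)/(I_2^{\perp})$, where $I_2^\perp\subset V^*\otimes V^*$ is the annihilator of $I_2\subset V\otimes V$ under the pairing $(y\otimes y',x\otimes x')=y(x)\,y'(x')$. If a group acts on $A$ by graded $\Bbbk$-algebra automorphisms, it acts on $V^*$ contragrediently and hence on $A^!$, and all $A_i$, $A^!_i$, $(A^!_i)^*$ are finite-dimensional representations of it. For a group $H$ let $R_\Bbbk(H)$ be the Grothendieck ring of finite-dimensional $\Bbbk H$-modules: the free abelian group on isomorphism classes $[U]$ modulo the $\mathbb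 Z$-span of all $[U]-[U']-[U'']$ for short exact sequences $0\to U'\to U\to U''\to 0$, with product $[U]\cdot[W]=[U\otimes_\Bbbk W]$. **Proposition.** Let $G$ be a group and $H\le G$ a subgroup. Let $A$ and $B$ be Koszul $\Bbbk$-algebras, with $G$ acting on $A$ and $H$ acting on $B$ by graded $\Bbbk$-algebra automorphisms, and let $\mathcal X$ be a finite-dimensional $\Bbbk H$-module. Write $\downarrow$ for restriction from $G$ to $H$, and let terms with index $-1$ be $0$. Then the following three statements, each an identity in $R_\Bbbk(H)$ for all $i\ge 0$, are equivalent: 1. $[A_i\downarrow]=[B_i]+[\mathcal X]\cdot[B_{i-1}]$ for all $i$; 2. $[(A^!_i)^*\downarrow]=[(B^!_i)^*]+[\mathcal X]\cdot[(A^!_{i-1})^*\downarrow]$ for all $i$; 3. $[A^!_i\downarrow]=[B^!_i]+[\mathcal X^*]\cdot[A^!_{i-1}\downarrow]$ for all $i$. -/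

import Mathlib

open scoped TensorProduct

universe u v

namespace KoszulBranching

noncomputable section

/-! ### The Grothendieck ring of finite-dimensional representations -/

/-- A finite-dimensional `kG`-module, given as a representation of `G` on a `k`-vector space. -/
structure FinRep (k : Type u) [Field k] (G : Type v) [Group G] where
  V : Type u
  [addCommGroup : AddCommGroup V]
  [module : Module k V]
  [finite : Module.Finite k V]
  ρ : Representation k G V

attribute [instance] FinRep.addCommGroup FinRep.module FinRep.finite

variable (k : Type u) [Field k] (G : Type v) [Group G]

/-- Isomorphism of finite-dimensional `kG`-modules. -/
instance FinRep.setoid : Setoid (FinRep k G) where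
  r U W := Nonempty (U.ρ.Equiv W.ρ)
  iseqv :=
    { refl := fun _ => ⟨Representation.Equiv.refl _⟩
      symm := fun ⟨e⟩ => ⟨e.symm⟩
      trans := fun ⟨e⟩ ⟨f⟩ => ⟨e.trans f⟩ }

/-- The isomorphism classes of finite-dimensional `kG`-modules. -/
def IsoClass : Type (max (u + 1) v) := Quotient (FinRep.setoid k G)

variable {k G}

/-- The isomorphism class of a finite-dimensional `kG`-module. -/
def isoClass {V : Type u} [AddCommGroup V] [Module k V] [Module.Finite k V]
    (ρ : Representation k G V) : IsoClass k G :=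
  Quotient.mk (FinRep.setoid k G) ⟨V, ρ⟩

theorem isoClass_eq {V W : Type u} [AddCommGroup V] [Module k V] [Module.Finite k V]
    [AddCommGroup W] [Module k W] [Module.Finite k W]
    {ρ : Representation k G V} {σ : Representation k G W} (e : ρ.Equiv σ) :
    isoClass ρ = isoClass σ :=
  Quotient.sound (s := FinRep.setoid k G) (a := ⟨V, ρ⟩) (b := ⟨W, σ⟩) ⟨e⟩

/-- An isomorphism of tensor products from isomorphisms of the factors. -/
def tprodCongr {V V' W W' : Type u} [AddCommGroup V] [Module k V] [AddCommGroup V'] [Module k V']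
    [AddCommGroup W] [Module k W] [AddCommGroup W'] [Module k W']
    {ρ : Representation k G V} {ρ' : Representation k G V'}
    {σ : Representation k G W} {σ' : Representation k G W'}
    (e : ρ.Equiv ρ') (f : σ.Equiv σ') : (ρ.tprod σ).Equiv (ρ'.tprod σ') :=
  .mk (TensorProduct.congr e.toLinearEquiv f.toLinearEquiv) fun g =>
    (e.toIntertwiningMap.tensor f.toIntertwiningMap).isIntertwining' g

/-- Isomorphism classes form a commutative monoid under the tensor product over `k` with diagonal
action; the unit is the trivial module `k`. -/
instance : CommMonoid (IsoClass k G) where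
  mul := Quotient.map₂ (fun U W => ⟨U.V ⊗[k] W.V, U.ρ.tprod W.ρ⟩)
    fun _ _ ⟨e⟩ _ _ ⟨f⟩ => ⟨tprodCongr e f⟩
  one := isoClass (Representation.trivial k G k)
  mul_assoc a b c := by
    induction a using Quotient.inductionOn
    induction b using Quotient.inductionOn
    induction c using Quotient.inductionOn
    exact isoClass_eq (Representation.TensorProduct.assoc _ _ _)
  one_mul a := by
    induction a using Quotient.inductionOn
    exact isoClass_eq (Representation.TensorProduct.lid k _)
  mul_one a := by
    induction a using Quotient.inductionOn
    exact isoClass_eq (Representation.TensorProduct.rid k _)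
  mul_comm a b := by
    induction a using Quotient.inductionOn
    induction b using Quotient.inductionOn
    exact isoClass_eq (Representation.TensorProduct.comm _ _)

variable (k G) in
/-- The relators `[V] - ([U] + [W])`, one for each short exact sequence `0 → U → V → W → 0` of
finite-dimensional `kG`-modules. -/
def relators : Set (FreeAbelianGroup (IsoClass k G)) :=
  {x | ∃ (U V W : FinRep k G) (f : U.ρ.IntertwiningMap V.ρ) (g : V.ρ.IntertwiningMap W.ρ),
    Function.Injective f ∧ Function.Exact f g ∧ Function.Surjective g ∧
    x = .of (isoClass V.ρ) - (.of (isoClass U.ρ) + .of (isoClass W.ρ))}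

theorem of_mul_relator (a : IsoClass k G) {x : FreeAbelianGroup (IsoClass k G)}
    (hx : x ∈ relators k G) : .of a * x ∈ relators k G := by
  obtain ⟨U, V, W, f, g, hf, hfg, hg, rfl⟩ := hx
  induction a using Quotient.inductionOn with
  | _ Z =>
    refine ⟨⟨_, Z.ρ.tprod U.ρ⟩, ⟨_, Z.ρ.tprod V.ρ⟩, ⟨_, Z.ρ.tprod W.ρ⟩, f.lTensor Z.ρ,
      g.lTensor Z.ρ, ?_, ?_, ?_, ?_⟩
    · exact Module.Flat.lTensor_preserves_injective_linearMap f.toLinearMap hf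
    · exact lTensor_exact Z.V (f := f.toLinearMap) (g := g.toLinearMap) hfg hg
    · exact LinearMap.lTensor_surjective Z.V (g := g.toLinearMap) hg
    · rw [mul_sub, mul_add]
      rfl

variable (k G) in
/-- The `ℤ`-span of the relators, which is an ideal. -/
def relatorIdeal : Ideal (FreeAbelianGroup (IsoClass k G)) where
  __ := AddSubgroup.closure (relators k G)
  smul_mem' c x hx := by
    change x ∈ AddSubgroup.closure (relators k G) at hx
    change c * x ∈ AddSubgroup.closure (relators k G)
    induction c using FreeAbelianGroup.induction_on with
    | zero => simp
    | of a =>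
      induction hx using AddSubgroup.closure_induction with
      | mem x hx => exact AddSubgroup.subset_closure (of_mul_relator a hx)
      | zero => simp
      | add x y _ _ hx hy => rw [mul_add]; exact add_mem hx hy
      | neg x _ hx => rw [mul_neg]; exact neg_mem hx
    | neg a ha => rw [neg_mul]; exact neg_mem ha
    | add a b ha hb => rw [add_mul]; exact add_mem ha hb

variable (k G) in
/-- The Grothendieck ring `R_k(G)`: the free abelian group on the isomorphism classes of
finite-dimensional `kG`-modules modulo the `ℤ`-span of the relators, with multiplication induced
by the tensor product. -/
abbrev GrothendieckRing : Type (max (u + 1) v) :=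
  FreeAbelianGroup (IsoClass k G) ⧸ relatorIdeal k G

/-- The class `[V]` in `R_k(G)` of a finite-dimensional `kG`-module. -/
def cls {V : Type u} [AddCommGroup V] [Module k V] [Module.Finite k V]
    (ρ : Representation k G V) : GrothendieckRing k G :=
  Ideal.Quotient.mk (relatorIdeal k G) (.of (isoClass ρ))

/-- Restriction of a representation to a subgroup. -/
abbrev res (H : Subgroup G) {V : Type u} [AddCommGroup V] [Module k V]
    (ρ : Representation k G V) : Representation k H V :=
  ρ.comp H.subtype

/-! ### Standard graded algebras and Koszul algebras -/

section Graded

variable {A : Type u} [Ring A] [Algebra k A] (𝒜 : ℕ → Submodule k A) [GradedAlgebra 𝒜]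

/-- A standard graded algebra: a nonzero graded algebra that is generated by its component of
degree one, which is finite-dimensional. Equivalently, `A` is `T(V)/I` with `V = 𝒜 1`
finite-dimensional and `I` a homogeneous two-sided ideal with `I = I₂ ⊕ I₃ ⊕ ⋯`. -/
class StandardGraded : Prop where
  nontrivial : Nontrivial A
  finite_one : Module.Finite k (𝒜 1)
  generated : Algebra.adjoin k (𝒜 1 : Set A) = ⊤

/-- A linear resolution of `k = A/A₊` by free left `A`-modules. The `i`-th module is free with
basis `Fin (rank i)` placed in degree `i`; the differentials are `A`-linear and their matrix
entries are homogeneous of degree one. The module in homological degree `0` is `A`, with the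
canonical surjection to `A/A₊` as augmentation. -/
structure LinearResolution where
  rank : ℕ → ℕ
  rank_zero : rank 0 = 1
  d : ∀ i, (Fin (rank (i + 1)) → A) →ₗ[A] (Fin (rank i) → A)
  linear : ∀ i p q, d i (Pi.single p 1) q ∈ 𝒜 1
  exact_zero : ∀ v : Fin (rank 0) → A,
    v ∈ LinearMap.range (d 0) ↔ ∀ q, v q ∈ (HomogeneousIdeal.irrelevant 𝒜).toIdeal
  exact_succ : ∀ i, Function.Exact (d (i + 1)) (d i)

/-- A standard graded algebra is Koszul if the trivial left module `A/A₊` has a linear free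
resolution. -/
class IsKoszul : Prop extends StandardGraded 𝒜 where
  resolution : Nonempty (LinearResolution 𝒜)


/-- Each component of a standard graded algebra is spanned by products of elements of degree
one, hence is finite-dimensional. -/
instance finite_component [h : StandardGraded 𝒜] (i : ℕ) : Module.Finite k (𝒜 i) := by
  have key : ∀ t : TensorAlgebra k (𝒜 1), ∀ i,
      (DirectSum.decompose 𝒜 (TensorAlgebra.lift k (𝒜 1).subtype t) i : A) ∈ (𝒜 1) ^ i := by
    have hpow : ∀ (j : ℕ) (t : TensorAlgebra k (𝒜 1)),
        t ∈ LinearMap.range (TensorAlgebra.ι k (M := 𝒜 1)) ^ j →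
        TensorAlgebra.lift k (𝒜 1).subtype t ∈ (𝒜 1) ^ j := by
      intro j t ht
      have h1 := Submodule.mem_map_of_mem (f := (TensorAlgebra.lift k (𝒜 1).subtype).toLinearMap) ht
      rw [Submodule.map_pow, ← LinearMap.range_comp] at h1
      have h2 : (TensorAlgebra.lift k (𝒜 1).subtype).toLinearMap ∘ₗ TensorAlgebra.ι k
          = (𝒜 1).subtype := by
        ext x
        simp
      rwa [h2, Submodule.range_subtype] at h1
    have hle : ∀ j, (𝒜 1) ^ j ≤ 𝒜 j := by
      intro j
      induction j with
      | zero =>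
        rw [pow_zero, Submodule.one_le]
        exact SetLike.GradedOne.one_mem
      | succ j ih =>
        rw [pow_succ, Submodule.mul_le]
        intro a ha b hb
        exact SetLike.GradedMul.mul_mem (ih ha) hb
    intro t
    induction t using DirectSum.Decomposition.inductionOn
      (fun j => LinearMap.range (TensorAlgebra.ι k (M := 𝒜 1)) ^ j) with
    | zero => intro i; simp
    | @homogeneous j m =>
      intro i
      have hm := hpow j _ m.2
      by_cases hij : j = i
      · subst hij
        rwa [DirectSum.decompose_of_mem_same 𝒜 (hle _ hm)]
      · rw [DirectSum.decompose_of_mem_ne 𝒜 (hle _ hm) hij]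
        exact zero_mem _
    | add x y hx hy =>
      intro i
      rw [map_add, DirectSum.decompose_add, DirectSum.add_apply, Submodule.coe_add]
      exact add_mem (hx i) (hy i)
  have hsurj : Function.Surjective (TensorAlgebra.lift k (𝒜 1).subtype) := by
    rw [← AlgHom.range_eq_top, eq_top_iff, ← h.generated, Algebra.adjoin_le_iff]
    intro a ha
    exact ⟨TensorAlgebra.ι k ⟨a, ha⟩, by simp⟩
  have hle : 𝒜 i ≤ (𝒜 1) ^ i := by
    intro a ha
    obtain ⟨t, rfl⟩ := hsurj a
    have := key t i
    rwa [DirectSum.decompose_of_mem_same 𝒜 ha] at this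
  have hfin := h.finite_one
  have hfg : ((𝒜 1) ^ i).FG := Submodule.FG.pow (Module.Finite.iff_fg.mp hfin) i
  have : Module.Finite k ↥((𝒜 1) ^ i) := Module.Finite.iff_fg.mpr hfg
  exact Submodule.finiteDimensional_of_le hle

/-! ### The quadratic dual -/

/-- The space `I₂` of quadratic relations: the kernel of `V ⊗ V → A`, where `V = 𝒜 1`. -/
def quadraticRelations : Submodule k (𝒜 1 ⊗[k] 𝒜 1) :=
  LinearMap.ker (LinearMap.mul' k A ∘ₗ TensorProduct.map (𝒜 1).subtype (𝒜 1).subtype)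

end Graded

section Quadratic

variable {V : Type u} [AddCommGroup V] [Module k V]

/-- The inclusion of `V ⊗ V` as the degree-two component of the tensor algebra. -/
def tensorSquare : V ⊗[k] V →ₗ[k] TensorAlgebra k V :=
  LinearMap.mul' k _ ∘ₗ TensorProduct.map (TensorAlgebra.ι k) (TensorAlgebra.ι k)

/-- The two-sided ideal of `T(V)` generated by a subspace `R` of `V ⊗ V`. -/
def quadraticIdeal (R : Submodule k (V ⊗[k] V)) : TwoSidedIdeal (TensorAlgebra k V) :=
  TwoSidedIdeal.span (tensorSquare '' (R : Set (V ⊗[k] V)))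

/-- The quadratic algebra `T(V)/(R)`. -/
abbrev QuadraticQuotient (R : Submodule k (V ⊗[k] V)) : Type u :=
  (quadraticIdeal R).ringCon.Quotient

/-- The projection `T(V) → T(V)/(R)`. -/
abbrev QuadraticQuotient.mk (R : Submodule k (V ⊗[k] V)) :
    TensorAlgebra k V →ₐ[k] QuadraticQuotient R :=
  (quadraticIdeal R).ringCon.mkₐ k

/-- The component of degree `i` of `T(V)/(R)`: the image of `Tⁱ(V)`. -/
def QuadraticQuotient.component (R : Submodule k (V ⊗[k] V)) (i : ℕ) :
    Submodule k (QuadraticQuotient R) :=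
  (LinearMap.range (TensorAlgebra.ι k (M := V)) ^ i).map (QuadraticQuotient.mk R).toLinearMap

instance [Module.Finite k V] (R : Submodule k (V ⊗[k] V)) (i : ℕ) :
    Module.Finite k (QuadraticQuotient.component R i) := by
  refine Module.Finite.iff_fg.mpr (Submodule.FG.map _ (Submodule.FG.pow ?_ i))
  exact Module.Finite.iff_fg.mp inferInstance

/-- The algebra endomorphism of `T(V)` induced by a linear endomorphism of `V`. -/
def tensorAlgebraMap (f : V →ₗ[k] V) : TensorAlgebra k V →ₐ[k] TensorAlgebra k V :=
  TensorAlgebra.lift k (TensorAlgebra.ι k ∘ₗ f)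

theorem tensorAlgebraMap_tensorSquare (f : V →ₗ[k] V) (q : V ⊗[k] V) :
    tensorAlgebraMap f (tensorSquare q) = tensorSquare (TensorProduct.map f f q) := by
  induction q with
  | zero => simp
  | tmul x y => simp [tensorSquare, tensorAlgebraMap]
  | add x y hx hy => simp [hx, hy]

/-- A linear endomorphism `f` of `V` with `(f ⊗ f)(R) ⊆ R` induces an algebra endomorphism of
`T(V)/(R)`. -/
def QuadraticQuotient.map (R : Submodule k (V ⊗[k] V)) (f : V →ₗ[k] V)
    (hf : R ≤ R.comap (TensorProduct.map f f)) :
    QuadraticQuotient R →ₐ[k] QuadraticQuotient R :=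
  (quadraticIdeal R).ringCon.liftₐ ((QuadraticQuotient.mk R).comp (tensorAlgebraMap f)) <| by
    have h : quadraticIdeal R ≤
        TwoSidedIdeal.ker ((QuadraticQuotient.mk R).comp (tensorAlgebraMap f)) := by
      refine TwoSidedIdeal.span_le.mpr ?_
      rintro _ ⟨q, hq, rfl⟩
      change _ ∈ TwoSidedIdeal.ker _
      rw [TwoSidedIdeal.mem_ker, AlgHom.comp_apply, tensorAlgebraMap_tensorSquare]
      have h0 : tensorSquare (TensorProduct.map f f q) ∈ quadraticIdeal R :=
        TwoSidedIdeal.subset_span ⟨_, hf hq, rfl⟩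
      exact (RingCon.eq _).mpr ((TwoSidedIdeal.mem_iff _ _).mp h0)
    intro x y hxy
    have h1 := h ((TwoSidedIdeal.rel_iff _ x y).mp hxy)
    rw [TwoSidedIdeal.mem_ker, map_sub, sub_eq_zero] at h1
    exact h1

theorem QuadraticQuotient.map_mk (R : Submodule k (V ⊗[k] V)) (f : V →ₗ[k] V)
    (hf : R ≤ R.comap (TensorProduct.map f f)) (t : TensorAlgebra k V) :
    QuadraticQuotient.map R f hf (QuadraticQuotient.mk R t) =
      QuadraticQuotient.mk R (tensorAlgebraMap f t) :=
  rfl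

theorem QuadraticQuotient.mk_surjective (R : Submodule k (V ⊗[k] V)) :
    Function.Surjective (QuadraticQuotient.mk R) :=
  RingCon.mk'_surjective _

theorem tensorAlgebraMap_one : tensorAlgebraMap (1 : V →ₗ[k] V) = AlgHom.id k _ := by
  ext v
  simp [tensorAlgebraMap]

theorem tensorAlgebraMap_mul (f g : V →ₗ[k] V) :
    tensorAlgebraMap (f * g) = (tensorAlgebraMap f).comp (tensorAlgebraMap g) := by
  ext v
  simp [tensorAlgebraMap]

/-- The action of `G` on `T(V)/(R)` by algebra automorphisms induced by a linear action on `V`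
that preserves `R`. -/
def QuadraticQuotient.rep (R : Submodule k (V ⊗[k] V)) (σ : Representation k G V)
    (hR : ∀ g, R ≤ R.comap (TensorProduct.map (σ g) (σ g))) :
    Representation k G (QuadraticQuotient R) where
  toFun g := (QuadraticQuotient.map R (σ g) (hR g)).toLinearMap
  map_one' := by
    ext x
    obtain ⟨t, rfl⟩ := QuadraticQuotient.mk_surjective R x
    rw [AlgHom.toLinearMap_apply, QuadraticQuotient.map_mk, map_one, tensorAlgebraMap_one]
    rfl
  map_mul' g h := by
    ext x
    obtain ⟨t, rfl⟩ := QuadraticQuotient.mk_surjective R x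
    rw [AlgHom.toLinearMap_apply, QuadraticQuotient.map_mk, map_mul, tensorAlgebraMap_mul]
    rfl

theorem QuadraticQuotient.rep_mem (R : Submodule k (V ⊗[k] V)) (σ : Representation k G V)
    (hR : ∀ g, R ≤ R.comap (TensorProduct.map (σ g) (σ g))) (i : ℕ) (g : G) :
    component R i ≤ (component R i).comap (QuadraticQuotient.rep R σ hR g) := by
  rintro _ ⟨t, ht, rfl⟩
  refine ⟨tensorAlgebraMap (σ g) t, ?_, rfl⟩
  have h1 := Submodule.mem_map_of_mem (f := (tensorAlgebraMap (σ g)).toLinearMap) ht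
  rw [Submodule.map_pow, ← LinearMap.range_comp] at h1
  refine pow_le_pow_left' (M := Submodule k (TensorAlgebra k V)) ?_ i h1
  rintro _ ⟨v, rfl⟩
  exact ⟨σ g v, by simp [tensorAlgebraMap]⟩

/-- The representation of `G` on the component of degree `i` of `T(V)/(R)`. -/
def QuadraticQuotient.componentRep (R : Submodule k (V ⊗[k] V)) (σ : Representation k G V)
    (hR : ∀ g, R ≤ R.comap (TensorProduct.map (σ g) (σ g))) (i : ℕ) :
    Representation k G (component R i) :=
  (QuadraticQuotient.rep R σ hR).subrepresentation _ (QuadraticQuotient.rep_mem R σ hR i)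

/-- The annihilator of `R ⊆ V ⊗ V` in `V* ⊗ V*`, for the pairing
`(y ⊗ y', x ⊗ x') = y(x) y'(x')`. -/
def perp (R : Submodule k (V ⊗[k] V)) :
    Submodule k (Module.Dual k V ⊗[k] Module.Dual k V) :=
  R.dualAnnihilator.comap (TensorProduct.dualDistrib k V V)

theorem perp_stable (R : Submodule k (V ⊗[k] V)) (σ : Representation k G V)
    (hR : ∀ g, R ≤ R.comap (TensorProduct.map (σ g) (σ g))) (g : G) :
    perp R ≤ (perp R).comap (TensorProduct.map (σ.dual g) (σ.dual g)) := by
  intro p hp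
  have key : TensorProduct.dualDistrib k V V (TensorProduct.map (σ.dual g) (σ.dual g) p) =
      TensorProduct.dualDistrib k V V p ∘ₗ TensorProduct.map (σ g⁻¹) (σ g⁻¹) := by
    clear hp
    induction p with
    | zero => simp
    | tmul x y => ext a b; simp [Representation.dual_apply, Module.Dual.transpose_apply]
    | add x y hx hy => simp only [map_add, hx, hy, LinearMap.add_comp]
  rw [perp, Submodule.mem_comap, Submodule.mem_comap, Submodule.mem_dualAnnihilator, key]
  rw [perp, Submodule.mem_comap, Submodule.mem_dualAnnihilator] at hp
  exact fun q hq => hp _ (hR g⁻¹ hq)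

end Quadratic

/-! ### Groups acting on graded algebras and on their quadratic duals -/

section Action

variable {A : Type u} [Ring A] [Algebra k A] (𝒜 : ℕ → Submodule k A)

variable (G) in
/-- An action of `G` on a graded algebra by graded `k`-algebra automorphisms. -/
structure GradedAction where
  toHom : G →* (A ≃ₐ[k] A)
  map_mem : ∀ g i a, a ∈ 𝒜 i → toHom g a ∈ 𝒜 i

/-- The component `A^!_i` of the quadratic dual algebra `A^! = T(V*)/(I₂^⊥)`, where `V = 𝒜 1`. -/
abbrev dualComponent (i : ℕ) :
    Submodule k (QuadraticQuotient (perp (quadraticRelations 𝒜))) :=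
  QuadraticQuotient.component (perp (quadraticRelations 𝒜)) i

variable {𝒜}

/-- The representation of `G` on the component `A_i`. -/
def GradedAction.rep (α : GradedAction G 𝒜) (i : ℕ) : Representation k G (𝒜 i) where
  toFun g := (α.toHom g).toLinearMap.restrict (α.map_mem g i)
  map_one' := by ext; simp
  map_mul' g h := by ext; simp; rfl

theorem GradedAction.quadraticRelations_stable (α : GradedAction G 𝒜) (g : G) :
    quadraticRelations 𝒜 ≤
      (quadraticRelations 𝒜).comap (TensorProduct.map (α.rep 1 g) (α.rep 1 g)) := by
  have key : ∀ q : 𝒜 1 ⊗[k] 𝒜 1,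
      LinearMap.mul' k A (TensorProduct.map (𝒜 1).subtype (𝒜 1).subtype
        (TensorProduct.map (α.rep 1 g) (α.rep 1 g) q)) =
      α.toHom g (LinearMap.mul' k A (TensorProduct.map (𝒜 1).subtype (𝒜 1).subtype q)) := by
    intro q
    induction q with
    | zero => simp
    | tmul x y => exact (map_mul (α.toHom g) (x : A) (y : A)).symm
    | add x y hx hy => simp only [map_add, hx, hy]
  intro q hq
  rw [quadraticRelations, LinearMap.mem_ker, LinearMap.comp_apply] at hq
  rw [Submodule.mem_comap, quadraticRelations, LinearMap.mem_ker, LinearMap.comp_apply, key, hq,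
    map_zero]

/-- The representation of `G` on the component `A^!_i` of the quadratic dual, induced by the
contragredient action on `V* = (𝒜 1)*`. -/
def GradedAction.dualRep (α : GradedAction G 𝒜) (i : ℕ) :
    Representation k G (dualComponent 𝒜 i) :=
  QuadraticQuotient.componentRep _ (α.rep 1).dual
    (perp_stable _ _ α.quadraticRelations_stable) i

end Action

instance dualComponent_finite {A : Type u} [Ring A] [Algebra k A] (𝒜 : ℕ → Submodule k A)
    [GradedAlgebra 𝒜] [h : StandardGraded 𝒜] (i : ℕ) : Module.Finite k (dualComponent 𝒜 i) :=
  inferInstance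

/-- The sequence shifted by one: `(c_{i-1})_i`, with `c_{-1} = 0`. -/
def prev {M : Type*} [Zero M] (c : ℕ → M) : ℕ → M
  | 0 => 0
  | i + 1 => c i

end

end KoszulBranching

open KoszulBranching

namespace KoszulBranching

noncomputable section

/-! ### Classes in the Grothendieck ring -/

section Classes

variable {k : Type u} [Field k] {G : Type v} [Group G]
  {U V W : Type u} [AddCommGroup U] [Module k U] [Module.Finite k U]
  [AddCommGroup V] [Module k V] [Module.Finite k V]
  [AddCommGroup W] [Module k W] [Module.Finite k W]
  {τ : Representation k G U} {ρ : Representation k G V} {σ : Representation k G W}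

/-! The engine is the identity `koszul_identity`: for a Koszul algebra with group action, the series
with coefficients `[A_i]` and `(-1)^i [(A^!_i)^*]` are mutually inverse over the Grothendieck ring.
Write `A(t)`, `B(t)` for the series of `[A_i]`, `[B_i]`, and `A'(-t)`, `B'(-t)` for their inverses.
Statement 1 reads `A(t) = (1 + xt) B(t)` with `x` the class of the extra module, and statement 2
reads `(1 + xt) A'(-t) = B'(-t)`; multiplying by inverses exchanges them (`powerSeries_branching`).
Statements 2 and 3 are exchanged by dualization, an additive map on the Grothendieck ring that is
multiplicative and involutive on classes.

The inverse relation is the Euler characteristic of an exact Koszul complex. Koszulness supplies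
only a linear resolution `P`, which carries no group action, so the classes cannot be read off from
it. The complex with terms `Hom(A^!_i, A_j)` is canonical, hence equivariant, and `P` serves to
prove it exact. For this, a comparison map `toDual` identifies the dual of the degree `i` generators
of `P` with `A^!_i`. Its existence uses exactness of `P`; it is injective because `A^!` acts on the
duals of the generators (the relations act by zero as `d ∘ d = 0`), and it hits all of `A^!_i`
because `A^!` is generated in degree one. In the resulting basis of `A^!_i` the Koszul differential
has the same matrix as the differential of `P` (`coe_koszulD_dualBasis`), so exactness transfers. -/

theorem cls_eq (e : ρ.Equiv σ) : cls ρ = cls σ := by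
  rw [cls, cls, isoClass_eq e]

theorem cls_eq_add (f : τ.IntertwiningMap ρ) (g : ρ.IntertwiningMap σ)
    (hf : Function.Injective f) (hfg : Function.Exact f g) (hg : Function.Surjective g) :
    cls ρ = cls τ + cls σ := by
  rw [cls, cls, cls, ← map_add]
  refine Ideal.Quotient.eq.mpr ?_
  exact AddSubgroup.subset_closure ⟨⟨U, τ⟩, ⟨V, ρ⟩, ⟨W, σ⟩, f, g, hf, hfg, hg, rfl⟩

theorem cls_tprod : cls (ρ.tprod σ) = cls ρ * cls σ := by
  rw [cls, cls, cls, ← map_mul, ← FreeAbelianGroup.of_mul]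
  rfl

theorem cls_trivial : cls (Representation.trivial k G k) = 1 := rfl

/-- For a zero module the sequence `0 → V → V → V → 0` of identity maps is exact, which forces `[V]
= [V] + [V]`. -/
theorem cls_of_subsingleton [Subsingleton V] : cls ρ = 0 := by
  have h := cls_eq_add (τ := ρ) (ρ := ρ) (σ := ρ) (.id ρ) (.id ρ) (fun _ _ h => h)
    (fun x => by simp [Subsingleton.elim x 0]) (fun x => ⟨x, rfl⟩)
  simpa using h

theorem cls_linHom : cls (ρ.linHom σ) = cls ρ.dual * cls σ := by
  rw [← cls_tprod]
  refine (cls_eq (.mk (dualTensorHomEquiv k V W) fun g => ?_)).symm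
  exact Representation.dualTensorHom_comm ρ σ g

/-- The transpose of an intertwining map. -/
def dualMap (f : τ.IntertwiningMap ρ) : ρ.dual.IntertwiningMap τ.dual where
  toLinearMap := f.toLinearMap.dualMap
  isIntertwining' g := by
    ext y x
    exact congrArg y (f.isIntertwining _ _ g⁻¹ x).symm

/-- Duality over a field is exact but reverses arrows, so the two summands change places. This makes
dualization well defined on the Grothendieck ring. -/
theorem cls_dual_eq_add (f : τ.IntertwiningMap ρ) (g : ρ.IntertwiningMap σ)
    (hf : Function.Injective f) (hfg : Function.Exact f g) (hg : Function.Surjective g) :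
    cls ρ.dual = cls τ.dual + cls σ.dual := by
  rw [add_comm]
  refine cls_eq_add (dualMap g) (dualMap f) ?_ ?_ ?_
  · exact LinearMap.dualMap_injective_of_surjective (f := g.toLinearMap) hg
  · have h1 : LinearMap.ker g.toLinearMap = LinearMap.range f.toLinearMap :=
      LinearMap.exact_iff.mp hfg
    have h2 : LinearMap.ker f.toLinearMap.dualMap = LinearMap.range g.toLinearMap.dualMap := by
      rw [LinearMap.ker_dualMap_eq_dualAnnihilator_range,
        LinearMap.range_dualMap_eq_dualAnnihilator_ker, h1]
    exact LinearMap.exact_iff.mpr h2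
  · exact LinearMap.dualMap_surjective_of_injective (f := f.toLinearMap) hf

theorem cls_dual_dual : cls ρ.dual.dual = cls ρ := by
  refine (cls_eq (.mk (Module.evalEquiv k V) fun g => ?_)).symm
  ext x y
  simp [Representation.dual_apply, Module.Dual.transpose_apply]

/-- The dual of an isomorphism of representations. -/
def dualEquiv (e : ρ.Equiv σ) : ρ.dual.Equiv σ.dual :=
  .mk e.toLinearEquiv.symm.dualMap fun g => by
    ext y x
    exact congrArg y (e.symm.toIntertwiningMap.isIntertwining _ _ g⁻¹ x).symm

theorem cls_dual_tprod : cls (ρ.tprod σ).dual = cls ρ.dual * cls σ.dual := by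
  rw [← cls_tprod]
  refine (cls_eq (.mk (TensorProduct.dualDistribEquiv k V W) fun g => ?_)).symm
  ext x y v w
  simp [TensorProduct.dualDistribEquiv, TensorProduct.dualDistribEquivOfBasis,
    Representation.dual_apply, Module.Dual.transpose_apply]

theorem cls_dual_trivial : cls (Representation.trivial k G k).dual = 1 := by
  rw [← cls_trivial]
  refine cls_eq (.mk (LinearMap.ringLmapEquivSelf k k k) fun g => ?_)
  ext y
  simp [Representation.dual_apply, Module.Dual.transpose_apply]

end Classes

/-! ### Dualization on the Grothendieck ring -/

section DualHom

variable (k : Type u) [Field k] (G : Type v) [Group G]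

/-- Dualization of isomorphism classes. -/
def IsoClass.dual : IsoClass k G → IsoClass k G :=
  Quotient.map (fun U => ⟨Module.Dual k U.V, U.ρ.dual⟩) fun _ _ ⟨e⟩ => ⟨dualEquiv e⟩

/-- Dualization on the Grothendieck ring, as an additive map. -/
def dualAddHom : GrothendieckRing k G →+ GrothendieckRing k G :=
  QuotientAddGroup.lift (relatorIdeal k G).toAddSubgroup
    (FreeAbelianGroup.lift fun a =>
      Ideal.Quotient.mk (relatorIdeal k G) (.of (IsoClass.dual k G a))) <| by
    have h : AddSubgroup.closure (relators k G) ≤ (FreeAbelianGroup.lift fun a =>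
        Ideal.Quotient.mk (relatorIdeal k G) (.of (IsoClass.dual k G a))).ker := by
      refine (AddSubgroup.closure_le _).mpr ?_
      rintro _ ⟨U, V, W, f, g, hf, hfg, hg, rfl⟩
      rw [SetLike.mem_coe, AddMonoidHom.mem_ker, map_sub, map_add, sub_eq_zero]
      simp only [FreeAbelianGroup.lift_apply_of]
      exact cls_dual_eq_add f g hf hfg hg
    exact h

variable {k G}

theorem dualAddHom_cls {V : Type u} [AddCommGroup V] [Module k V] [Module.Finite k V]
    (ρ : Representation k G V) : dualAddHom k G (cls ρ) = cls ρ.dual := by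
  change FreeAbelianGroup.lift _ (FreeAbelianGroup.of _) = _
  rw [FreeAbelianGroup.lift_apply_of]
  rfl

end DualHom

/-! ### Power series -/

/-- The hypotheses say that the signed series of `a'` and `b'` are inverse to the series of `a` and
`b`. Both sides of the equivalence are then the same linear relation, up to multiplication by units.
-/
theorem powerSeries_branching {R : Type*} [CommRing R] {a a' b b' : ℕ → R}
    (ha : ∀ n, ∑ p ∈ Finset.HasAntidiagonal.antidiagonal n,
      (-1) ^ p.1 * a' p.1 * a p.2 = if n = 0 then 1 else 0)
    (hb : ∀ n, ∑ p ∈ Finset.HasAntidiagonal.antidiagonal n,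
      (-1) ^ p.1 * b' p.1 * b p.2 = if n = 0 then 1 else 0)
    (x : R) :
    (∀ i, a i = b i + x * prev b i) ↔ (∀ i, a' i = b' i + x * prev a' i) := by
  open PowerSeries in
  have hprev : ∀ c : ℕ → R, PowerSeries.mk (prev c) = X * PowerSeries.mk c := by
    intro c
    ext (_ | n)
    · simp [prev]
    · simp [prev, coeff_succ_X_mul]
  have hA : PowerSeries.mk (fun i => (-1) ^ i * a' i) * PowerSeries.mk a = 1 := by
    ext n
    simp [PowerSeries.coeff_mul, PowerSeries.coeff_one, ha]
  have hB : PowerSeries.mk (fun i => (-1) ^ i * b' i) * PowerSeries.mk b = 1 := by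
    ext n
    simp [PowerSeries.coeff_mul, PowerSeries.coeff_one, hb]
  have h1 : (∀ i, a i = b i + x * prev b i) ↔
      PowerSeries.mk a =
        PowerSeries.mk b + PowerSeries.C x * (PowerSeries.X * PowerSeries.mk b) := by
    rw [← hprev, PowerSeries.ext_iff]
    simp
  have h2 : (∀ i, a' i = b' i + x * prev a' i) ↔
      PowerSeries.mk (fun i => (-1) ^ i * a' i) = PowerSeries.mk (fun i => (-1) ^ i * b' i) -
        PowerSeries.C x * (PowerSeries.X * PowerSeries.mk (fun i => (-1) ^ i * a' i)) := by
    rw [← hprev, PowerSeries.ext_iff]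
    refine forall_congr' fun i => ?_
    -- Shifting the signed sequence by one leaves a sign behind, which turns `+ x` into `- x`.
    have hp : prev (fun i => (-1) ^ i * a' i) i = (-1) * (-1) ^ i * prev a' i := by
      cases i with
      | zero => simp [prev]
      | succ i => simp [prev, pow_succ]
    simp only [map_sub, PowerSeries.coeff_mk, PowerSeries.coeff_C_mul, hp]
    constructor
    · intro h
      linear_combination (-1) ^ i * h
    · intro h
      have h3 : ((-1 : R) ^ i) * (-1) ^ i = 1 := by rw [← mul_pow]; simp
      linear_combination (-1) ^ i * h - (a' i - b' i - x * prev a' i) * h3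
  rw [h1, h2]
  set A := PowerSeries.mk a
  set B := PowerSeries.mk b
  set A' := PowerSeries.mk (fun i => (-1) ^ i * a' i)
  set B' := PowerSeries.mk (fun i => (-1) ^ i * b' i)
  constructor
  · intro h
    linear_combination (-B' * A') * h + (A' + A' * PowerSeries.C x * PowerSeries.X) * (-hB) +
      B' * hA
  · intro h
    linear_combination (-A * B) * h + (B + B * PowerSeries.C x * PowerSeries.X) * hA - A * hB

/-! ### Linear resolutions -/

theorem exists_comp_eq_of_ker_le {k V W N : Type*} [Field k] [AddCommGroup V] [Module k V]
    [AddCommGroup W] [Module k W] [AddCommGroup N] [Module k N] (f : V →ₗ[k] W) (g : V →ₗ[k] N)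
    (h : LinearMap.ker f ≤ LinearMap.ker g) : ∃ ψ : W →ₗ[k] N, ψ ∘ₗ f = g := by
  obtain ⟨s, hs⟩ := LinearMap.exists_leftInverse_of_injective _
    (Submodule.ker_liftQ_eq_bot' (LinearMap.ker f) f rfl)
  refine ⟨(LinearMap.ker f).liftQ g h ∘ₗ s, LinearMap.ext fun v => ?_⟩
  have h1 := LinearMap.congr_fun hs ((LinearMap.ker f).mkQ v)
  simp only [LinearMap.comp_apply, Submodule.mkQ_apply, Submodule.liftQ_apply,
    LinearMap.id_apply] at h1 ⊢
  rw [h1, Submodule.liftQ_apply]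

section Components

variable {k : Type u} [Field k] {A : Type u} [Ring A] [Algebra k A]
  (𝒜 : ℕ → Submodule k A) [GradedAlgebra 𝒜]

/-- The elements whose degree-zero part is a scalar form a subalgebra containing `𝒜 1`, and `𝒜 1`
generates. -/
theorem mem_component_zero [h : StandardGraded 𝒜] {a : A} (ha : a ∈ 𝒜 0) :
    ∃ c : k, algebraMap k A c = a := by
  let S : Subalgebra k A :=
    { carrier := {b | (DirectSum.decompose 𝒜 b 0 : A) ∈ (⊥ : Subalgebra k A)}
      mul_mem' := fun {x y} hx hy => by
        have := map_mul (GradedRing.projZeroRingHom 𝒜) x y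
        simp only [GradedRing.projZeroRingHom_apply] at this
        rw [Set.mem_ofPred_eq, this]
        exact mul_mem hx hy
      add_mem' := fun {x y} hx hy => by
        rw [Set.mem_ofPred_eq, DirectSum.decompose_add]
        exact add_mem hx hy
      algebraMap_mem' := fun c => by
        rw [Set.mem_ofPred_eq,
          DirectSum.decompose_of_mem_same 𝒜 (SetLike.algebraMap_mem_graded 𝒜 c)]
        exact Subalgebra.algebraMap_mem _ c }
  have hS : S = ⊤ := by
    rw [eq_top_iff, ← h.generated, Algebra.adjoin_le_iff]
    intro b hb
    change (DirectSum.decompose 𝒜 b 0 : A) ∈ (⊥ : Subalgebra k A)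
    rw [DirectSum.decompose_of_mem_ne 𝒜 hb one_ne_zero]
    exact zero_mem _
  have : a ∈ S := hS ▸ Algebra.mem_top
  change (DirectSum.decompose 𝒜 a 0 : A) ∈ (⊥ : Subalgebra k A) at this
  rwa [DirectSum.decompose_of_mem_same 𝒜 ha, Algebra.mem_bot] at this

end Components

namespace LinearResolution

variable {k : Type u} [Field k] {A : Type u} [Ring A] [Algebra k A]
  {𝒜 : ℕ → Submodule k A} [GradedAlgebra 𝒜] (P : LinearResolution 𝒜)

/-- The entries of the matrices of the differentials. -/
def entry (i : ℕ) (p : Fin (P.rank (i + 1))) (q : Fin (P.rank i)) : 𝒜 1 :=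
  ⟨P.d i (Pi.single p 1) q, P.linear i p q⟩

theorem d_apply (i : ℕ) (v : Fin (P.rank (i + 1)) → A) (q : Fin (P.rank i)) :
    P.d i v q = ∑ p, v p * (P.entry i p q : A) := by
  conv_lhs => rw [← Finset.univ_sum_single v]
  rw [map_sum, Finset.sum_apply]
  refine Finset.sum_congr rfl fun p _ => ?_
  have : Pi.single p (v p) = v p • (Pi.single p 1 : Fin (P.rank (i + 1)) → A) := by
    rw [← Pi.single_smul, smul_eq_mul, mul_one]
  rw [this, map_smul, Pi.smul_apply, smul_eq_mul]
  rfl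

theorem d_d (i : ℕ) (s : Fin (P.rank (i + 2))) (q : Fin (P.rank i)) :
    ∑ p, (P.entry (i + 1) s p : A) * (P.entry i p q : A) = 0 := by
  rw [← P.d_apply i (fun p => (P.entry (i + 1) s p : A)) q]
  exact congrFun ((P.exact_succ i).apply_apply_eq_zero (Pi.single s 1)) q

/-- Since the matrix entries have degree one, the degree `j` parts of any preimage already form a
preimage. -/
theorem exists_of_mem_range (i j : ℕ) {v : Fin (P.rank i) → A} (hv : ∀ q, v q ∈ 𝒜 (j + 1))
    (h : v ∈ LinearMap.range (P.d i)) :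
    ∃ w : Fin (P.rank (i + 1)) → 𝒜 j, ∀ q, v q = ∑ p, (w p : A) * (P.entry i p q : A) := by
  obtain ⟨w, rfl⟩ := h
  refine ⟨fun p => DirectSum.decompose 𝒜 (w p) j, fun q => ?_⟩
  rw [← DirectSum.decompose_of_mem_same 𝒜 (hv q), d_apply, DirectSum.decompose_sum,
    DFinsupp.finsetSum_apply, Submodule.coe_sum]
  exact Finset.sum_congr rfl fun p _ =>
    DirectSum.coe_decompose_mul_add_of_right_mem 𝒜 (P.entry i p q).2

theorem eq_zero_of_mem_range (i : ℕ) {v : Fin (P.rank i) → A} (hv : ∀ q, v q ∈ 𝒜 0)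
    (h : v ∈ LinearMap.range (P.d i)) : v = 0 := by
  obtain ⟨w, rfl⟩ := h
  funext q
  rw [← DirectSum.decompose_of_mem_same 𝒜 (hv q), d_apply, DirectSum.decompose_sum,
    DFinsupp.finsetSum_apply, Submodule.coe_sum]
  exact Finset.sum_eq_zero fun p _ =>
    DirectSum.coe_decompose_mul_of_right_mem_of_not_le 𝒜 (P.entry i p q).2 (by omega)

theorem mem_range_zero (j : ℕ) {v : Fin (P.rank 0) → A} (hv : ∀ q, v q ∈ 𝒜 (j + 1)) :
    v ∈ LinearMap.range (P.d 0) :=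
  (P.exact_zero v).mpr fun q =>
    HomogeneousIdeal.mem_irrelevant_of_mem 𝒜 (Nat.succ_pos j) (hv q)

theorem mem_range_succ (i : ℕ) {v : Fin (P.rank (i + 1)) → A}
    (hv : ∀ q, ∑ p, v p * (P.entry i p q : A) = 0) : v ∈ LinearMap.range (P.d (i + 1)) :=
  (P.exact_succ i v).mp (funext fun q => (P.d_apply i v q).trans (hv q))

/-- The action of a functional `y` on `A₁` as a map from the generators of homological degree `i`
to those of homological degree `i + 1`. -/
def act (i : ℕ) :
    Module.Dual k (𝒜 1) →ₗ[k] (Fin (P.rank i) → k) →ₗ[k] (Fin (P.rank (i + 1)) → k) :=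
  LinearMap.mk₂ k (fun y f p => ∑ q, y (P.entry i p q) * f q)
    (fun y y' f => by ext p; simp [add_mul, Finset.sum_add_distrib])
    (fun c y f => by ext p; simp [mul_assoc, Finset.mul_sum])
    (fun y f f' => by ext p; simp [mul_add, Finset.sum_add_distrib])
    (fun c y f => by ext p; simp [mul_left_comm, Finset.mul_sum])

theorem act_apply (i : ℕ) (y : Module.Dual k (𝒜 1)) (f : Fin (P.rank i) → k)
    (p : Fin (P.rank (i + 1))) : P.act i y f p = ∑ q, y (P.entry i p q) * f q := rfl

theorem act_single (i : ℕ) (y : Module.Dual k (𝒜 1)) (q : Fin (P.rank i)) :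
    P.act i y (Pi.single q 1) = fun p => y (P.entry i p q) := by
  ext p
  simp [act_apply, Pi.single_apply]

/-- The vectors `P.act i y v` span. A functional that kills them all has coefficients `c` with `∑ c
p • entry i p q = 0`, so `c` is a cycle in degree zero. By exactness it is a boundary, and
boundaries have no degree-zero part. -/
theorem act_hom_ext [h : StandardGraded 𝒜] {i : ℕ} {N : Type*} [AddCommGroup N] [Module k N]
    {f g : (Fin (P.rank (i + 1)) → k) →ₗ[k] N}
    (hfg : ∀ y v, f (P.act i y v) = g (P.act i y v)) : f = g := by
  have := h.nontrivial
  rw [← sub_eq_zero]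
  ext p
  refine (Module.forall_dual_apply_eq_zero_iff k _).mp fun μ => ?_
  let w : (Fin (P.rank (i + 1)) → k) →ₗ[k] k := μ ∘ₗ (f - g)
  have hw : ∀ y v, w (P.act i y v) = 0 := fun y v => by simp [w, hfg]
  let c : Fin (P.rank (i + 1)) → k := fun p => w (Pi.single p 1)
  have hwc : ∀ v, w v = ∑ p, c p * v p := fun v => by
    rw [LinearMap.pi_apply_eq_sum_univ w v]
    refine Finset.sum_congr rfl fun p _ => ?_
    rw [smul_eq_mul, mul_comm]
    congr 2
    ext j
    simp [Pi.single_apply, eq_comm]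
  have h0 : ∀ q, ∑ p, c p • P.entry i p q = 0 := fun q => by
    refine (Module.forall_dual_apply_eq_zero_iff k _).mp fun y => ?_
    rw [map_sum, ← hw y (Pi.single q 1), act_single, hwc]
    simp
  have h1 : (fun p => algebraMap k A (c p)) ∈ LinearMap.range (P.d (i + 1)) := by
    refine P.mem_range_succ i fun q => ?_
    have := congrArg Subtype.val (h0 q)
    simpa [Algebra.smul_def] using this
  have h2 := P.eq_zero_of_mem_range (i + 1)
    (fun p => SetLike.algebraMap_mem_graded 𝒜 (c p)) h1
  have h3 : algebraMap k A (c p) = 0 := congrFun h2 p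
  rw [map_eq_zero] at h3
  exact h3

/-- Dual form of exactness: `L` factors through `P.act i` once each `μ ∘ L`, read as a vector of
elements of `A₁` by biduality, lies in the image of `d i`. Such a vector is a scalar combination of
the rows of the matrix of `d i`, so `μ ∘ L` vanishes on the kernel of `P.act i`. -/
theorem exists_extension [StandardGraded 𝒜] (i : ℕ) {N : Type*} [AddCommGroup N] [Module k N]
    (L : Module.Dual k (𝒜 1) →ₗ[k] (Fin (P.rank i) → k) →ₗ[k] N)
    (hL : ∀ (μ : Module.Dual k N) (v : Fin (P.rank i) → 𝒜 1),
      (∀ y q, y (v q) = μ (L y (Pi.single q 1))) →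
        (fun q => (v q : A)) ∈ LinearMap.range (P.d i)) :
    ∃ ψ : (Fin (P.rank (i + 1)) → k) →ₗ[k] N, ∀ y f, ψ (P.act i y f) = L y f := by
  have hfin : Module.Finite k (𝒜 1) := inferInstance
  set M := TensorProduct.lift (P.act i) with hM
  set L' := TensorProduct.lift L with hL'
  have hker : LinearMap.ker M ≤ LinearMap.ker L' := by
    intro t ht
    rw [LinearMap.mem_ker] at ht ⊢
    refine (Module.forall_dual_apply_eq_zero_iff k _).mp fun μ => ?_
    -- The element of `A₁` representing the functional `y ↦ μ (L y e_q)` on `A₁*`.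
    let v : Fin (P.rank i) → 𝒜 1 := fun q =>
      (Module.evalEquiv k (𝒜 1)).symm (μ ∘ₗ L.flip (Pi.single q 1))
    have hv : ∀ y q, y (v q) = μ (L y (Pi.single q 1)) := fun y q => by
      simp [v]
    obtain ⟨w, hw⟩ := P.exists_of_mem_range i 0 (fun q => (v q).2) (hL μ v hv)
    choose c hc using fun p => mem_component_zero 𝒜 (w p).2
    have hvc : ∀ q, v q = ∑ p, c p • P.entry i p q := fun q => by
      ext
      simp [hw, ← hc, Algebra.smul_def]
    have hfac : μ ∘ₗ L' = (∑ p, c p • LinearMap.proj p) ∘ₗ M := by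
      refine TensorProduct.ext (LinearMap.ext fun y => ?_)
      ext q
      simp [hM, hL', ← hv, hvc, act_single]
    have := LinearMap.congr_fun hfac t
    simpa [ht] using this
  obtain ⟨ψ, hψ⟩ := exists_comp_eq_of_ker_le
    (V := Module.Dual k (𝒜 1) ⊗[k] (Fin (P.rank i) → k)) M L' hker
  refine ⟨ψ, fun y f => ?_⟩
  simpa [hM, hL'] using LinearMap.congr_fun hψ (y ⊗ₜ f)

end LinearResolution

/-! ### The quadratic dual of a Koszul algebra -/

section QuadraticDual

variable {k : Type u} [Field k] {A : Type u} [Ring A] [Algebra k A] (𝒜 : ℕ → Submodule k A)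

/-- The quadratic dual algebra. -/
abbrev QuadraticDual : Type u := QuadraticQuotient (perp (quadraticRelations 𝒜))

/-- The degree one generators of the quadratic dual. -/
def dualGen : Module.Dual k (𝒜 1) →ₗ[k] QuadraticDual 𝒜 :=
  (QuadraticQuotient.mk (perp (quadraticRelations 𝒜))).toLinearMap ∘ₗ TensorAlgebra.ι k

theorem mk_tensorSquare {V : Type u} [AddCommGroup V] [Module k V]
    {R : Submodule k (V ⊗[k] V)} {t : V ⊗[k] V} (ht : t ∈ R) :
    QuadraticQuotient.mk R (tensorSquare t) = 0 := by
  have h0 : tensorSquare t ∈ quadraticIdeal R := TwoSidedIdeal.subset_span ⟨_, ht, rfl⟩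
  exact (RingCon.eq _).mpr ((TwoSidedIdeal.mem_iff _ _).mp h0)

theorem dualComponent_eq (i : ℕ) : dualComponent 𝒜 i = LinearMap.range (dualGen 𝒜) ^ i := by
  rw [dualComponent, QuadraticQuotient.component, Submodule.map_pow, ← LinearMap.range_comp]
  rfl

theorem dualGen_mul_mem {i : ℕ} (y : Module.Dual k (𝒜 1)) {e : QuadraticDual 𝒜}
    (he : e ∈ dualComponent 𝒜 i) : dualGen 𝒜 y * e ∈ dualComponent 𝒜 (i + 1) := by
  rw [dualComponent_eq] at he ⊢
  rw [pow_succ']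
  exact Submodule.mul_mem_mul ⟨y, rfl⟩ he

end QuadraticDual

/-! ### Comparison of the generators of the resolution with the quadratic dual -/

namespace LinearResolution

variable {k : Type u} [Field k] {A : Type u} [Ring A] [Algebra k A]
  {𝒜 : ℕ → Submodule k A} [GradedAlgebra 𝒜] (P : LinearResolution 𝒜)

/-- The position of the basis element of homological degree `0`. -/
def base : Fin (P.rank 0) := ⟨0, by rw [P.rank_zero]; exact Nat.one_pos⟩

theorem eq_base (q : Fin (P.rank 0)) : q = P.base := by
  have := P.rank_zero
  ext
  have := q.2
  simp only [base]
  omega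

open Classical in
/-- The comparison map from the dual of the generators of the resolution to the quadratic dual,
determined by `P.toDual (i + 1) (P.act i y f) = dualGen 𝒜 y * P.toDual i f`. -/
def toDual : ∀ i, (Fin (P.rank i) → k) →ₗ[k] QuadraticDual 𝒜
  | 0 => Algebra.linearMap k _ ∘ₗ LinearMap.proj P.base
  | i + 1 =>
    -- The default `0` is never taken for a standard graded algebra: `toDual_act` shows that the
    -- extension exists.
    if h : ∃ ψ : (Fin (P.rank (i + 1)) → k) →ₗ[k] QuadraticDual 𝒜,
      ∀ y f, ψ (P.act i y f) = dualGen 𝒜 y * toDual i f then h.choose else 0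

theorem toDual_zero (f : Fin (P.rank 0) → k) :
    P.toDual 0 f = algebraMap k _ (f P.base) := rfl

theorem entry_tensor_mem (i : ℕ) (s : Fin (P.rank (i + 2))) (q : Fin (P.rank i)) :
    ∑ p, P.entry (i + 1) s p ⊗ₜ[k] P.entry i p q ∈ quadraticRelations 𝒜 := by
  rw [quadraticRelations, LinearMap.mem_ker, map_sum, ← P.d_d i s q]
  simp

theorem toDual_act [StandardGraded 𝒜] (i : ℕ) (y : Module.Dual k (𝒜 1))
    (f : Fin (P.rank i) → k) : P.toDual (i + 1) (P.act i y f) = dualGen 𝒜 y * P.toDual i f := by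
  suffices h : ∃ ψ : (Fin (P.rank (i + 1)) → k) →ₗ[k] QuadraticDual 𝒜,
      ∀ y f, ψ (P.act i y f) = dualGen 𝒜 y * P.toDual i f by
    rw [toDual, dif_pos h]
    exact h.choose_spec y f
  clear y f
  induction i with
  | zero =>
    -- No condition arises here, since every element of `A₁` lies in the augmentation ideal.
    exact P.exists_extension 0
      ((LinearMap.mul k (QuadraticDual 𝒜)).compl₁₂ (dualGen 𝒜) (P.toDual 0))
      fun μ v _ => P.mem_range_zero 0 fun q => (v q).2
  | succ i ih =>
    have hi : ∀ y f, P.toDual (i + 1) (P.act i y f) = dualGen 𝒜 y * P.toDual i f := by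
      rw [toDual, dif_pos ih]
      exact ih.choose_spec
    refine P.exists_extension (i + 1)
      ((LinearMap.mul k (QuadraticDual 𝒜)).compl₁₂ (dualGen 𝒜) (P.toDual (i + 1)))
      fun μ v hv => P.mem_range_succ i fun q => ?_
    -- The cycle condition `∑ v p * entry i p q = 0` says that this tensor is a quadratic relation.
    -- It is tested against `I₂^⊥`: pairing with `t` gives `μ` of `t` times an element of `A^!`, and
    -- `t` is zero in `A^!`.
    have hmem : ∑ p, v p ⊗ₜ[k] P.entry i p q ∈ quadraticRelations 𝒜 := by
      refine (Subspace.forall_mem_dualAnnihilator_apply_eq_zero_iff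
        (K := k) (V := 𝒜 1 ⊗[k] 𝒜 1)
        (quadraticRelations 𝒜) _).mp fun η hη => ?_
      obtain ⟨t, rfl⟩ := (TensorProduct.dualDistribEquiv k (𝒜 1) (𝒜 1)).surjective η
      have ht : t ∈ perp (quadraticRelations 𝒜) := hη
      have key : ∀ t : Module.Dual k (𝒜 1) ⊗[k] Module.Dual k (𝒜 1),
          TensorProduct.dualDistrib k (𝒜 1) (𝒜 1) t (∑ p, v p ⊗ₜ[k] P.entry i p q) =
            μ (QuadraticQuotient.mk (perp (quadraticRelations 𝒜)) (tensorSquare t) *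
              P.toDual i (Pi.single q 1)) := by
        intro t
        induction t with
        | zero => simp
        | add x y hx hy => simp only [map_add, LinearMap.add_apply, add_mul, hx, hy]
        | tmul x y =>
          have h1 : QuadraticQuotient.mk (perp (quadraticRelations 𝒜)) (tensorSquare (x ⊗ₜ[k] y)) =
              dualGen 𝒜 x * dualGen 𝒜 y := by
            simp [tensorSquare, dualGen]
          rw [h1, mul_assoc, ← hi, P.act_single,
            ← Finset.univ_sum_single fun p => y (P.entry i p q)]
          simp only [map_sum, Finset.mul_sum, TensorProduct.dualDistrib_apply, hv]
          refine Finset.sum_congr rfl fun p _ => ?_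
          have h2 : (Pi.single p (y (P.entry i p q)) : Fin (P.rank (i + 1)) → k) =
              y (P.entry i p q) • Pi.single p 1 := by
            rw [← Pi.single_smul, smul_eq_mul, mul_one]
          rw [h2, map_smul, mul_smul_comm, map_smul, smul_eq_mul, mul_comm]
          rfl
      refine (key t).trans ?_
      rw [mk_tensorSquare ht, zero_mul, map_zero]
    rw [quadraticRelations, LinearMap.mem_ker, map_sum] at hmem
    simpa using hmem

/-- The generators of homological degree `0` of the resolution, as an element of the module on
which the quadratic dual acts. -/
def vacuum : ∀ i, Fin (P.rank i) → k := Pi.single 0 fun _ => 1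

/-- A functional on `A₁` as an operator on the product of the duals of the generators of the
resolution. -/
def operator : Module.Dual k (𝒜 1) →ₗ[k] Module.End k (∀ i, Fin (P.rank i) → k) where
  toFun y :=
    { toFun := fun f i => match i with
        | 0 => 0
        | i + 1 => P.act i y (f i)
      map_add' := fun f f' => by ext (_ | i) p <;> simp
      map_smul' := fun c f => by ext (_ | i) p <;> simp }
  map_add' y y' := by ext f (_ | i) p <;> simp
  map_smul' c y := by ext f (_ | i) p <;> simp

theorem operator_apply_zero (y : Module.Dual k (𝒜 1)) (f : ∀ i, Fin (P.rank i) → k) :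
    P.operator y f 0 = 0 := rfl

theorem operator_apply_succ (y : Module.Dual k (𝒜 1)) (f : ∀ i, Fin (P.rank i) → k) (i : ℕ) :
    P.operator y f (i + 1) = P.act i y (f i) := rfl

theorem operator_single (y : Module.Dual k (𝒜 1)) (i : ℕ) (f : Fin (P.rank i) → k) :
    P.operator y (Pi.single i f) = Pi.single (i + 1) (P.act i y f) := by
  funext j
  cases j with
  | zero => rw [operator_apply_zero, Pi.single_eq_of_ne (by omega)]
  | succ j =>
    rw [operator_apply_succ]
    by_cases h : j = i
    · subst h
      simp
    · rw [Pi.single_eq_of_ne h, Pi.single_eq_of_ne (by omega), map_zero]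

/-- Two successive operators see the resolution only through the tensors `∑ entry ⊗ entry`. These
lie in `I₂` because `d ∘ d = 0`, so elements of `I₂^⊥` act by zero. -/
theorem lift_operator_tensorSquare (t : Module.Dual k (𝒜 1) ⊗[k] Module.Dual k (𝒜 1))
    (f : ∀ i, Fin (P.rank i) → k) (i : ℕ) (s : Fin (P.rank (i + 2))) :
    TensorAlgebra.lift k P.operator (tensorSquare t) f (i + 2) s =
      ∑ q, TensorProduct.dualDistrib k _ _ t
        (∑ p, P.entry (i + 1) s p ⊗ₜ[k] P.entry i p q) * f i q := by
  induction t with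
  | zero => simp
  | add x y hx hy => simp [hx, hy, add_mul, Finset.sum_add_distrib]
  | tmul x y =>
    simp only [tensorSquare, LinearMap.comp_apply, TensorProduct.map_tmul, LinearMap.mul'_apply,
      map_mul, TensorAlgebra.lift_ι_apply, Module.End.mul_apply, operator_apply_succ, act_apply,
      map_sum, TensorProduct.dualDistrib_apply, Finset.mul_sum, Finset.sum_mul, mul_assoc]
    exact Finset.sum_comm

/-- The action of the quadratic dual on the product of the duals of the generators of the
resolution. -/
def dualAction : QuadraticDual 𝒜 →ₐ[k] Module.End k (∀ i, Fin (P.rank i) → k) :=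
  (quadraticIdeal (perp (quadraticRelations 𝒜))).ringCon.liftₐ
    (TensorAlgebra.lift k P.operator) <| by
    have h : quadraticIdeal (perp (quadraticRelations 𝒜)) ≤
        TwoSidedIdeal.ker (TensorAlgebra.lift k P.operator) := by
      refine TwoSidedIdeal.span_le.mpr ?_
      rintro _ ⟨t, ht, rfl⟩
      change _ ∈ TwoSidedIdeal.ker _
      rw [TwoSidedIdeal.mem_ker]
      refine LinearMap.ext fun f => funext fun i => ?_
      match i with
      -- Each operator raises the degree by one, so a product of two has no component in degrees `0`
      -- and `1`.
      | 0 | 1 =>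
        clear ht
        induction t with
        | zero => simp
        | add x y hx hy => rw [map_add, map_add, LinearMap.add_apply, Pi.add_apply, hx, hy]; simp
        | tmul x y => simp [tensorSquare, operator_apply_zero, operator_apply_succ]
      | i + 2 =>
        funext s
        rw [lift_operator_tensorSquare]
        refine Finset.sum_eq_zero fun q _ => ?_
        have h1 : TensorProduct.dualDistrib k _ _ t ∈ (quadraticRelations 𝒜).dualAnnihilator := ht
        rw [(Submodule.mem_dualAnnihilator _).mp h1 _ (P.entry_tensor_mem i s q), zero_mul]
    intro x y hxy
    have h1 := h ((TwoSidedIdeal.rel_iff _ x y).mp hxy)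
    rw [TwoSidedIdeal.mem_ker, map_sub, sub_eq_zero] at h1
    exact h1

theorem dualAction_dualGen (y : Module.Dual k (𝒜 1)) :
    P.dualAction (dualGen 𝒜 y) = P.operator y := by
  change TensorAlgebra.lift k P.operator (TensorAlgebra.ι k y) = _
  simp

/-- Acting on the vacuum undoes the comparison map, which yields its injectivity. -/
theorem dualAction_toDual [StandardGraded 𝒜] (i : ℕ) (f : Fin (P.rank i) → k) :
    P.dualAction (P.toDual i f) P.vacuum = Pi.single i f := by
  induction i with
  | zero =>
    rw [toDual_zero, AlgHom.commutes, Module.algebraMap_end_apply, vacuum, ← Pi.single_smul]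
    congr
    funext q
    simp [P.eq_base q]
  | succ i ih =>
    have : (LinearMap.applyₗ P.vacuum ∘ₗ P.dualAction.toLinearMap) ∘ₗ P.toDual (i + 1) =
        LinearMap.single k (fun i => Fin (P.rank i) → k) (i + 1) := by
      refine P.act_hom_ext fun y v => ?_
      simp [toDual_act, dualAction_dualGen, ih, operator_single]
    exact LinearMap.congr_fun this f

theorem toDual_injective [StandardGraded 𝒜] (i : ℕ) : Function.Injective (P.toDual i) := by
  intro f g h
  have h1 := P.dualAction_toDual i f
  rw [h, P.dualAction_toDual i g] at h1
  exact (Pi.single_injective i h1).symm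

/-- By induction: the vectors `P.act i y f` span the source and map to products `y * e` with `e` in
`A^!_i`, and such products span `A^!_{i+1}`. -/
theorem range_toDual [StandardGraded 𝒜] (i : ℕ) :
    LinearMap.range (P.toDual i) = dualComponent 𝒜 i := by
  induction i with
  | zero =>
    rw [dualComponent_eq, pow_zero, Submodule.one_eq_range]
    refine le_antisymm ?_ ?_
    · rintro _ ⟨f, rfl⟩
      exact ⟨f P.base, rfl⟩
    · rintro _ ⟨c, rfl⟩
      exact ⟨fun _ => c, rfl⟩
  | succ i ih =>
    refine le_antisymm ?_ ?_
    · have : (dualComponent 𝒜 (i + 1)).mkQ ∘ₗ P.toDual (i + 1) = 0 := by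
        refine P.act_hom_ext fun y v => ?_
        rw [LinearMap.comp_apply, toDual_act, LinearMap.zero_apply, Submodule.mkQ_apply,
          Submodule.Quotient.mk_eq_zero]
        exact dualGen_mul_mem 𝒜 y (ih ▸ LinearMap.mem_range_self _ v)
      rw [← Submodule.ker_mkQ (dualComponent 𝒜 (i + 1))]
      exact LinearMap.range_le_ker_iff.mpr this
    · rw [dualComponent_eq, pow_succ', ← dualComponent_eq, ← ih, Submodule.mul_le]
      rintro _ ⟨y, rfl⟩ _ ⟨f, rfl⟩
      exact ⟨P.act i y f, P.toDual_act i y f⟩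

/-- The basis of `A^!_i` dual to the generators of the resolution. -/
def dualBasis [StandardGraded 𝒜] (i : ℕ) : Module.Basis (Fin (P.rank i)) k (dualComponent 𝒜 i) :=
  .ofEquivFun <| ((LinearEquiv.ofInjective (P.toDual i) (P.toDual_injective i)).trans
    (LinearEquiv.ofEq _ _ (P.range_toDual i))).symm

theorem coe_dualBasis [StandardGraded 𝒜] (i : ℕ) (q : Fin (P.rank i)) :
    (P.dualBasis i q : QuadraticDual 𝒜) = P.toDual i (Pi.single q 1) := by
  simp [dualBasis]

theorem dualGen_mul_dualBasis [StandardGraded 𝒜] (i : ℕ) (y : Module.Dual k (𝒜 1))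
    (q : Fin (P.rank i)) :
    dualGen 𝒜 y * (P.dualBasis i q : QuadraticDual 𝒜) =
      ∑ p, y (P.entry i p q) • (P.dualBasis (i + 1) p : QuadraticDual 𝒜) := by
  simp only [coe_dualBasis, ← map_smul, ← map_sum, ← toDual_act, act_single]
  congr 1
  ext p
  simp [Pi.single_apply]

end LinearResolution

/-! ### Exact sequences of representations -/

section Kernels

variable {k : Type u} [Field k] {G : Type v} [Group G]
  {U V W : Type u} [AddCommGroup U] [Module k U]
  [AddCommGroup V] [Module k V]
  [AddCommGroup W] [Module k W]
  {τ : Representation k G U} {ρ : Representation k G V} {σ : Representation k G W}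

/-- The kernel of an intertwining map, as a representation. -/
def kerRep (f : τ.IntertwiningMap ρ) : Representation k G (LinearMap.ker f.toLinearMap) :=
  τ.subrepresentation _ fun g x hx => by
    have h : f x = 0 := hx
    have h1 : f (τ g x) = ρ g (f x) := f.isIntertwining _ _ g x
    rw [h, map_zero] at h1
    exact h1

variable [Module.Finite k U] [Module.Finite k V] [Module.Finite k W]

theorem cls_eq_ker_add (f : τ.IntertwiningMap ρ) (hf : Function.Surjective f) :
    cls τ = cls (kerRep f) + cls ρ :=
  cls_eq_add (τ := kerRep f) ⟨(LinearMap.ker f.toLinearMap).subtype, fun _ => rfl⟩ f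
    Subtype.val_injective
    (LinearMap.exact_subtype_ker_map f.toLinearMap) hf

omit [Module.Finite k W] in
-- By exactness the image of `f` is the kernel of `g`; this cuts a long exact sequence into short
-- ones.
theorem cls_eq_ker_add_ker (f : τ.IntertwiningMap ρ) (g : ρ.IntertwiningMap σ)
    (h : Function.Exact f g) : cls τ = cls (kerRep f) + cls (kerRep g) := by
  refine cls_eq_add (τ := kerRep f) ⟨(LinearMap.ker f.toLinearMap).subtype, fun _ => rfl⟩
    (σ := kerRep g) ⟨f.toLinearMap.codRestrict _ fun x => h.apply_apply_eq_zero x, fun a => ?_⟩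
    Subtype.val_injective ?_ ?_
  · ext x
    exact f.isIntertwining _ _ a x
  · intro x
    refine Iff.trans ?_ (LinearMap.exact_subtype_ker_map f.toLinearMap x)
    exact Subtype.ext_iff
  · rintro ⟨y, hy⟩
    obtain ⟨x, hx⟩ := (h y).mp hy
    exact ⟨x, Subtype.ext hx⟩

omit [Module.Finite k U] [Module.Finite k V] [Module.Finite k W] in
theorem linHom_apply_apply (g : G) (f : V →ₗ[k] W) (v : V) :
    ρ.linHom σ g f v = σ g (f (ρ g⁻¹ v)) := rfl

theorem cls_eq_one (v : V) (hv : Function.Bijective fun c : k => c • v) (h : ∀ g, ρ g v = v) :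
    cls ρ = 1 := by
  rw [← cls_trivial]
  refine (cls_eq (.mk (LinearEquiv.ofBijective (LinearMap.toSpanSingleton k V v) hv)
    fun g => ?_)).symm
  ext
  change (1 : k) • v = ρ g ((1 : k) • v)
  rw [map_smul, h]

end Kernels

theorem alternating_sum_eq {R : Type*} [CommRing R] {c z : ℕ → ℕ → R} (h0 : ∀ j, c 0 j = z 0 j)
    (hs : ∀ i j, c (i + 1) j = z (i + 1) j + z i (j + 1)) (n : ℕ) :
    ∑ p ∈ Finset.HasAntidiagonal.antidiagonal n, (-1) ^ p.1 * c p.1 p.2 = (-1) ^ n * z n 0 := by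
  rw [Finset.Nat.sum_antidiagonal_eq_sum_range_succ fun i j => (-1) ^ i * c i j]
  -- Telescoping: each term cancels the cycles left over by the previous partial sum and leaves its
  -- own.
  have key : ∀ m ≤ n, ∑ i ∈ Finset.range (m + 1), (-1) ^ i * c i (n - i) =
      (-1) ^ m * z m (n - m) := by
    intro m
    induction m with
    | zero => simp [h0]
    | succ m ih =>
      intro hm
      rw [Finset.sum_range_succ, ih (by omega), hs, show n - (m + 1) + 1 = n - m by omega]
      ring
  simpa using key n le_rfl

/-! ### Euler characteristic of an exact complex of representations -/

section EulerCharacteristic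

variable {k : Type u} [Field k] {G : Type v} [Group G] {C : ℕ → ℕ → Type u}
  [∀ i j, AddCommGroup (C i j)] [∀ i j, Module k (C i j)] [∀ i j, Module.Finite k (C i j)]
  {ρ : ∀ i j, Representation k G (C i j)}

/-- The class of the space of cycles in a family of complexes. -/
def cyclesCls (d : ∀ i j, (ρ (i + 1) j).IntertwiningMap (ρ i (j + 1))) :
    ℕ → ℕ → GrothendieckRing k G
  | 0, j => cls (ρ 0 j)
  | i + 1, j => cls (kerRep (d i j))

theorem alternating_sum_cls (d : ∀ i j, (ρ (i + 1) j).IntertwiningMap (ρ i (j + 1)))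
    (hinj : ∀ i, Function.Injective (d i 0)) (hsurj : ∀ j, Function.Surjective (d 0 j))
    (hexact : ∀ i j, Function.Exact (d (i + 1) j) (d i (j + 1))) (n : ℕ) :
    ∑ p ∈ Finset.HasAntidiagonal.antidiagonal n, (-1) ^ p.1 * cls (ρ p.1 p.2) =
      if n = 0 then cls (ρ 0 0) else 0 := by
  rw [alternating_sum_eq (c := fun i j => cls (ρ i j)) (z := cyclesCls d) (fun j => rfl) ?_ n]
  · cases n with
    | zero => simp [cyclesCls]
    | succ n =>
      have : Subsingleton (LinearMap.ker (d n 0).toLinearMap) := by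
        have h : LinearMap.ker (d n 0).toLinearMap = ⊥ := LinearMap.ker_eq_bot.mpr (hinj n)
        rw [h]
        infer_instance
      rw [cyclesCls, cls_of_subsingleton]
      simp
  · rintro (_ | i) j
    · exact cls_eq_ker_add (d 0 j) (hsurj j)
    · exact cls_eq_ker_add_ker (d (i + 1) j) (d i (j + 1)) (hexact i j)

end EulerCharacteristic

/-! ### The Koszul complex -/

section Koszul

variable {k : Type u} [Field k] {A : Type u} [Ring A] [Algebra k A]
  (𝒜 : ℕ → Submodule k A) [GradedAlgebra 𝒜]

/-- Left multiplication by the generators of the quadratic dual. -/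
def dualMulLeft (i : ℕ) :
    Module.Dual k (𝒜 1) →ₗ[k] dualComponent 𝒜 i →ₗ[k] dualComponent 𝒜 (i + 1) :=
  LinearMap.mk₂ k (fun y e => ⟨dualGen 𝒜 y * (e : QuadraticDual 𝒜), dualGen_mul_mem 𝒜 y e.2⟩)
    (fun y y' e => Subtype.ext <| by
      change dualGen 𝒜 (y + y') * (e : QuadraticDual 𝒜) = dualGen 𝒜 y * e + dualGen 𝒜 y' * e
      rw [map_add, add_mul])
    (fun c y e => Subtype.ext <| by
      change dualGen 𝒜 (c • y) * (e : QuadraticDual 𝒜) = c • (dualGen 𝒜 y * e)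
      rw [map_smul, smul_mul_assoc])
    (fun y e e' => Subtype.ext (mul_add _ _ _))
    (fun c y e => Subtype.ext (mul_smul_comm _ _ _))

omit [GradedAlgebra 𝒜] in
theorem coe_dualMulLeft (i : ℕ) (y : Module.Dual k (𝒜 1)) (e : dualComponent 𝒜 i) :
    (dualMulLeft 𝒜 i y e : QuadraticDual 𝒜) = dualGen 𝒜 y * e := rfl

/-- Right multiplication by an element of degree one. -/
def mulRightOne (j : ℕ) (x : 𝒜 1) : 𝒜 j →ₗ[k] 𝒜 (j + 1) :=
  (LinearMap.mulRight k (x : A)).restrict fun _ ha => SetLike.GradedMul.mul_mem ha x.2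

theorem coe_mulRightOne (j : ℕ) (x : 𝒜 1) (a : 𝒜 j) : (mulRightOne 𝒜 j x a : A) = a * x := rfl

variable [h : StandardGraded 𝒜]

/-- A basis of the component of degree one. -/
def basisOne : Module.Basis (Fin (Module.finrank k (𝒜 1))) k (𝒜 1) :=
  Module.finBasis k (𝒜 1)

/-- The differential of the Koszul complex, whose terms are the spaces `Hom(A^!_i, A_j)`. -/
def koszulD (i j : ℕ) : (dualComponent 𝒜 (i + 1) →ₗ[k] 𝒜 j) →ₗ[k]
    (dualComponent 𝒜 i →ₗ[k] 𝒜 (j + 1)) where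
  toFun φ := ∑ a, mulRightOne 𝒜 j (basisOne 𝒜 a) ∘ₗ φ ∘ₗ
    dualMulLeft 𝒜 i ((basisOne 𝒜).coord a)
  map_add' φ φ' := by
    simp [LinearMap.add_comp, LinearMap.comp_add, Finset.sum_add_distrib]
  map_smul' c φ := by
    simp [LinearMap.smul_comp, LinearMap.comp_smul, Finset.smul_sum]

theorem coe_koszulD (i j : ℕ) (φ : dualComponent 𝒜 (i + 1) →ₗ[k] 𝒜 j) (e : dualComponent 𝒜 i) :
    (koszulD 𝒜 i j φ e : A) =
      ∑ a, (φ (dualMulLeft 𝒜 i ((basisOne 𝒜).coord a) e) : A) * (basisOne 𝒜 a : A) := by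
  simp [koszulD, coe_mulRightOne]

theorem coe_eq_sum_coord (x : 𝒜 1) :
    (x : A) = ∑ a, (basisOne 𝒜).coord a x • (basisOne 𝒜 a : A) := by
  refine (congrArg (𝒜 1).subtype ((basisOne 𝒜).sum_repr x)).symm.trans ?_
  rw [map_sum]
  rfl

/-- Invariance of the canonical element `∑ x_a^* ⊗ x_a`: applying the transpose of `f` to the first
factor equals applying `f` to the second. Equivariance of the Koszul differential rests on this. -/
theorem sum_coord_mul (T : Module.Dual k (𝒜 1) →ₗ[k] A) (f : 𝒜 1 →ₗ[k] 𝒜 1) :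
    ∑ a, T ((basisOne 𝒜).coord a ∘ₗ f) * (basisOne 𝒜 a : A) =
      ∑ a, T ((basisOne 𝒜).coord a) * (f (basisOne 𝒜 a) : A) := by
  have h1 : ∀ a, (basisOne 𝒜).coord a ∘ₗ f =
      ∑ b, (basisOne 𝒜).coord a (f (basisOne 𝒜 b)) • (basisOne 𝒜).coord b := fun a => by
    refine (basisOne 𝒜).ext fun c => ?_
    simp [Finsupp.single_apply]
  have h2 := fun b => coe_eq_sum_coord 𝒜 (f (basisOne 𝒜 b))
  simp_rw [h1, h2, map_sum, map_smul, Finset.sum_mul, Finset.mul_sum, smul_mul_assoc,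
    mul_smul_comm]
  exact Finset.sum_comm

variable {𝒜}

/-- A map from `A^!_i` to `A_j`, evaluated on the dual basis, is a vector of degree `j` elements in
the `i`-th term of `P`. Under this identification the Koszul differential becomes that of `P`. -/
theorem coe_koszulD_dualBasis (P : LinearResolution 𝒜) (i j : ℕ)
    (φ : dualComponent 𝒜 (i + 1) →ₗ[k] 𝒜 j) (q : Fin (P.rank i)) :
    (koszulD 𝒜 i j φ (P.dualBasis i q) : A) =
      ∑ p, (φ (P.dualBasis (i + 1) p) : A) * (P.entry i p q : A) := by
  have h1 : ∀ y, dualMulLeft 𝒜 i y (P.dualBasis i q) =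
      ∑ p, y (P.entry i p q) • P.dualBasis (i + 1) p := fun y => by
    ext
    rw [coe_dualMulLeft, P.dualGen_mul_dualBasis]
    simp
  rw [coe_koszulD]
  simp_rw [h1, map_sum, map_smul, Submodule.coe_sum, Submodule.coe_smul, Finset.sum_mul]
  rw [Finset.sum_comm]
  refine Finset.sum_congr rfl fun p _ => ?_
  conv_rhs => rw [coe_eq_sum_coord 𝒜 (P.entry i p q), Finset.mul_sum]
  simp

theorem koszulD_injective (P : LinearResolution 𝒜) (i : ℕ) :
    Function.Injective (koszulD 𝒜 i 0) := by
  refine (injective_iff_map_eq_zero _).mpr fun φ hφ => ?_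
  refine (P.dualBasis (i + 1)).ext fun p => ?_
  have h1 : (fun p => (φ (P.dualBasis (i + 1) p) : A)) ∈ LinearMap.range (P.d (i + 1)) := by
    refine P.mem_range_succ i fun q => ?_
    rw [← coe_koszulD_dualBasis, hφ]
    rfl
  exact Subtype.ext (congrFun (P.eq_zero_of_mem_range (i + 1) (fun p => Subtype.prop _) h1) p)

theorem exists_koszulD_eq (P : LinearResolution 𝒜) (i j : ℕ)
    (φ : dualComponent 𝒜 i →ₗ[k] 𝒜 (j + 1))
    (hφ : (fun p => (φ (P.dualBasis i p) : A)) ∈ LinearMap.range (P.d i)) :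
    ∃ ψ, koszulD 𝒜 i j ψ = φ := by
  obtain ⟨w, hw⟩ := P.exists_of_mem_range i j (fun p => Subtype.prop _) hφ
  refine ⟨(P.dualBasis (i + 1)).constr k w, (P.dualBasis i).ext fun q => Subtype.ext ?_⟩
  rw [coe_koszulD_dualBasis, hw]
  simp

theorem koszulD_surjective (P : LinearResolution 𝒜) (j : ℕ) :
    Function.Surjective (koszulD 𝒜 0 j) := fun φ =>
  exists_koszulD_eq P 0 j φ (P.mem_range_zero j fun _ => Subtype.prop _)

theorem koszulD_exact (P : LinearResolution 𝒜) (i j : ℕ) :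
    Function.Exact (koszulD 𝒜 (i + 1) j) (koszulD 𝒜 i (j + 1)) := by
  intro φ
  constructor
  · intro hφ
    refine exists_koszulD_eq P (i + 1) j φ (P.mem_range_succ i fun q => ?_)
    rw [← coe_koszulD_dualBasis, hφ]
    rfl
  · rintro ⟨ψ, rfl⟩
    refine (P.dualBasis i).ext fun q => Subtype.ext ?_
    rw [coe_koszulD_dualBasis]
    simp_rw [coe_koszulD_dualBasis, Finset.sum_mul]
    rw [Finset.sum_comm]
    simp_rw [mul_assoc, ← Finset.mul_sum, P.d_d]
    simp

variable {G : Type v} [Group G] (α : GradedAction G 𝒜)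

omit [GradedAlgebra 𝒜] h in
theorem dualRep_dualMulLeft (i : ℕ) (g : G) (y : Module.Dual k (𝒜 1)) (e : dualComponent 𝒜 i) :
    α.dualRep (i + 1) g (dualMulLeft 𝒜 i y e) =
      dualMulLeft 𝒜 i ((α.rep 1).dual g y) (α.dualRep i g e) := by
  refine Subtype.ext ?_
  let F := QuadraticQuotient.map _ ((α.rep 1).dual g)
    (perp_stable _ _ α.quadraticRelations_stable g)
  have hF : F (dualGen 𝒜 y) = dualGen 𝒜 ((α.rep 1).dual g y) := by
    change QuadraticQuotient.mk _ (tensorAlgebraMap _ (TensorAlgebra.ι k y)) = _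
    rw [tensorAlgebraMap, TensorAlgebra.lift_ι_apply]
    rfl
  change F (dualGen 𝒜 y * e) = dualGen 𝒜 _ * F e
  rw [map_mul, hF]

theorem koszulD_equivariant (i j : ℕ) (g : G) (φ : dualComponent 𝒜 (i + 1) →ₗ[k] 𝒜 j) :
    koszulD 𝒜 i j ((α.dualRep (i + 1)).linHom (α.rep j) g φ) =
      (α.dualRep i).linHom (α.rep (j + 1)) g (koszulD 𝒜 i j φ) := by
  refine LinearMap.ext fun e => Subtype.ext ?_
  -- `T y = g φ(y · g⁻¹e)`. Both sides of the claim are sums of values of `T` over a basis, with `g`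
  -- placed on the functionals or on the basis vectors.
  let T : Module.Dual k (𝒜 1) →ₗ[k] A := (𝒜 j).subtype ∘ₗ α.rep j g ∘ₗ φ ∘ₗ
    (dualMulLeft 𝒜 i).flip (α.dualRep i g⁻¹ e)
  have h1 : (koszulD 𝒜 i j ((α.dualRep (i + 1)).linHom (α.rep j) g φ) e : A) =
      ∑ a, T ((basisOne 𝒜).coord a ∘ₗ α.rep 1 g) * (basisOne 𝒜 a : A) := by
    rw [coe_koszulD]
    refine Finset.sum_congr rfl fun a _ => ?_
    have h2 : (α.rep 1).dual g⁻¹ ((basisOne 𝒜).coord a) =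
        (basisOne 𝒜).coord a ∘ₗ α.rep 1 g := by
      ext x
      simp [Representation.dual_apply, Module.Dual.transpose_apply]
    rw [linHom_apply_apply, dualRep_dualMulLeft, h2]
    rfl
  have h3 : α.toHom g (koszulD 𝒜 i j φ (α.dualRep i g⁻¹ e)) =
      ∑ a, T ((basisOne 𝒜).coord a) * (α.rep 1 g (basisOne 𝒜 a) : A) := by
    rw [coe_koszulD, map_sum]
    exact Finset.sum_congr rfl fun a _ => map_mul _ _ _
  exact h1.trans ((sum_coord_mul 𝒜 T (α.rep 1 g)).trans h3.symm)

/-- The differential of the Koszul complex as a map of representations. -/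
def koszulMap (i j : ℕ) : ((α.dualRep (i + 1)).linHom (α.rep j)).IntertwiningMap
    ((α.dualRep i).linHom (α.rep (j + 1))) where
  toLinearMap := koszulD 𝒜 i j
  isIntertwining' g := LinearMap.ext fun φ => koszulD_equivariant α i j g φ

omit h in
theorem cls_rep_zero [StandardGraded 𝒜] : cls (α.rep 0) = 1 := by
  have := StandardGraded.nontrivial 𝒜
  refine cls_eq_one ⟨1, SetLike.GradedOne.one_mem⟩ ⟨?_, ?_⟩ fun g => Subtype.ext ?_
  · intro c c' hc
    have h1 : c • (1 : A) = c' • 1 := congrArg Subtype.val hc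
    rw [← Algebra.algebraMap_eq_smul_one, ← Algebra.algebraMap_eq_smul_one] at h1
    exact (algebraMap k A).injective h1
  · rintro ⟨a, ha⟩
    obtain ⟨c, rfl⟩ := mem_component_zero 𝒜 ha
    exact ⟨c, Subtype.ext (Algebra.algebraMap_eq_smul_one c).symm⟩
  · exact map_one (α.toHom g)

omit [GradedAlgebra 𝒜] h in
theorem one_mem_dualComponent : (1 : QuadraticDual 𝒜) ∈ dualComponent 𝒜 0 := by
  rw [dualComponent_eq, pow_zero]
  exact Submodule.one_le.mp le_rfl

/-- `A^!_0` consists of the scalars, which `G` fixes. That they do not collapse in `A^!` follows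
from injectivity of the comparison map. -/
theorem cls_dualRep_zero (P : LinearResolution 𝒜) : cls (α.dualRep 0) = 1 := by
  refine cls_eq_one ⟨1, one_mem_dualComponent⟩ ⟨?_, ?_⟩ fun g => Subtype.ext ?_
  · intro c c' hc
    have h1 : c • (1 : QuadraticDual 𝒜) = c' • 1 := congrArg Subtype.val hc
    rw [← Algebra.algebraMap_eq_smul_one, ← Algebra.algebraMap_eq_smul_one] at h1
    exact congrFun (P.toDual_injective 0 (a₁ := fun _ => c) (a₂ := fun _ => c') h1) P.base
  · rintro ⟨a, ha⟩
    rw [← P.range_toDual] at ha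
    obtain ⟨f, rfl⟩ := ha
    exact ⟨f P.base, Subtype.ext (Algebra.algebraMap_eq_smul_one _).symm⟩
  · exact map_one (QuadraticQuotient.map _ ((α.rep 1).dual g)
      (perp_stable _ _ α.quadraticRelations_stable g))

theorem cls_dualRep_dual_zero (P : LinearResolution 𝒜) : cls (α.dualRep 0).dual = 1 := by
  rw [← dualAddHom_cls, cls_dualRep_zero α P, ← cls_trivial, dualAddHom_cls, cls_dual_trivial,
    cls_trivial]

end Koszul

/-- Euler characteristic of the exact complex `Hom(A^!_i, A_j)`, `i + j = n`, with `[Hom(A^!_i,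
A_j)] = [(A^!_i)^*][A_j]`. Only `n = 0` survives, where both factors are trivial. -/
theorem koszul_identity {k : Type u} [Field k] {A : Type u} [Ring A] [Algebra k A]
    {𝒜 : ℕ → Submodule k A} [GradedAlgebra 𝒜] [h : IsKoszul 𝒜] {G : Type v} [Group G]
    (α : GradedAction G 𝒜) (n : ℕ) :
    ∑ p ∈ Finset.HasAntidiagonal.antidiagonal n,
      (-1) ^ p.1 * cls (α.dualRep p.1).dual * cls (α.rep p.2) = if n = 0 then 1 else 0 := by
  obtain ⟨P⟩ := h.resolution
  have hfin : ∀ i j, Module.Finite k (dualComponent 𝒜 i →ₗ[k] 𝒜 j) := fun i j => by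
    have := finite_component 𝒜 j
    have := dualComponent_finite 𝒜 i
    exact Module.Finite.linearMap k k _ _
  have key := alternating_sum_cls (C := fun i j => dualComponent 𝒜 i →ₗ[k] 𝒜 j)
    (ρ := fun i j => (α.dualRep i).linHom (α.rep j)) (koszulMap α) (koszulD_injective P)
    (koszulD_surjective P) (koszulD_exact P) n
  simpa only [cls_linHom, ← mul_assoc, cls_rep_zero, cls_dualRep_dual_zero α P, mul_one] using key

/-! ### Restriction to the subgroup and compatibility of duals with products -/

section Restriction

variable {k : Type u} [Field k] {A : Type u} [Ring A] [Algebra k A]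
  {𝒜 : ℕ → Submodule k A} {G : Type v} [Group G]

/-- Restriction of a graded action to a subgroup. -/
def GradedAction.restrict (α : GradedAction G 𝒜) (H : Subgroup G) : GradedAction H 𝒜 where
  toHom := α.toHom.comp H.subtype
  map_mem g := α.map_mem g

theorem dualAddHom_cls_mul {V W : Type u} [AddCommGroup V] [Module k V] [Module.Finite k V]
    [AddCommGroup W] [Module k W] [Module.Finite k W]
    (ρ : Representation k G V) (σ : Representation k G W) :
    dualAddHom k G (cls ρ * cls σ) = cls ρ.dual * cls σ.dual := by
  rw [← cls_tprod, dualAddHom_cls, cls_dual_tprod]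

end Restriction

end

end KoszulBranching

open KoszulBranching
theorem mainTheorem4 {k : Type u} [Field k] {G : Type v} [Group G] (H : Subgroup G)
    {A B : Type u} [Ring A] [Algebra k A] [Ring B] [Algebra k B]
    (𝒜 : ℕ → Submodule k A) [GradedAlgebra 𝒜] [IsKoszul 𝒜]
    (ℬ : ℕ → Submodule k B) [GradedAlgebra ℬ] [IsKoszul ℬ]
    (α : GradedAction G 𝒜) (β : GradedAction H ℬ)
    {X : Type u} [AddCommGroup X] [Module k X] [Module.Finite k X] (χ : Representation k H X) :
    ((∀ i, cls (res H (α.rep i)) =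
        cls (β.rep i) + cls χ * prev (fun j => cls (β.rep j)) i) ↔
      (∀ i, cls (res H (α.dualRep i).dual) =
        cls (β.dualRep i).dual + cls χ * prev (fun j => cls (res H (α.dualRep j).dual)) i)) ∧
    ((∀ i, cls (res H (α.dualRep i).dual) =
        cls (β.dualRep i).dual + cls χ * prev (fun j => cls (res H (α.dualRep j).dual)) i) ↔
      (∀ i, cls (res H (α.dualRep i)) =
        cls (β.dualRep i) + cls χ.dual * prev (fun j => cls (res H (α.dualRep j))) i)) := by
  constructor
  -- The restricted action is graded on the same algebra, and its representations are the
  -- restrictions by definition, so the Koszul identity for `A` holds over `H`.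
  · exact powerSeries_branching (koszul_identity (α.restrict H)) (koszul_identity β) (cls χ)
  · refine forall_congr' fun i => ?_
    have hres : ∀ j, cls (res H (α.dualRep j).dual) = cls (res H (α.dualRep j)).dual :=
      fun _ => rfl
    constructor
    · intro h
      -- Dualizing replaces each class by that of its dual, and double duals return the original
      -- classes.
      have h1 := congrArg (dualAddHom k H) h
      cases i with
      | zero => simpa [prev, hres, dualAddHom_cls, cls_dual_dual] using h1
      | succ i =>
        simpa only [prev, hres, map_add, dualAddHom_cls_mul, dualAddHom_cls, cls_dual_dual] using h1
    · intro h
      have h1 := congrArg (dualAddHom k H) h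
      cases i with
      | zero => simpa [prev, hres, dualAddHom_cls] using h1
      | succ i =>
        simpa only [prev, hres, map_add, dualAddHom_cls_mul, dualAddHom_cls, cls_dual_dual] using h1
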